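/- Let $(\phi_t)_{t\in\mathbb R}$ be a continuous flow on a nonempty compact metric space $K$. Let $C^0(K)$ be the space of continuous functions $K\to\mathbb R$ with the uniform norm, and let the space of Borel probability measures on $K$ carry the weak-$*$ topology. Let $\mathcal M_{inv}$ and $\mathcal M_{erg}$ be the sets of invariant and of ergodic Borel probability measures of the flow, and let $h_\mu(\phi)\in[0,\infty]$ be the metric entropy of $\mu\in\mathcal M_{inv}$, i.e. the Kolmogorov–Sinai entropy of the time-one map $\phi_1$ with respect to $\mu$. For $\varphi\in C^0(K)$ let $$\mathcal M_{max}(\varphi)=\Big\{\mu\in\mathcal M_{inv}:\ \int\varphi\,d\mu=\sup_{\nu\in\mathcal M_{inv}}\int\varphi\,d\nu\Big\}$$ be the set of maximizing measures of $\varphi$. A periodic measure is a measure $\frac1T\int_0^T\delta_{\phi_t(x)}\,dt$ with $T>0$ and $\phi_T(x)=x$. A subset of $C^0(K)$ is called residual if it is a dense $G_\delta$ set. Consider the following properties. - $\mathcal P_e^+$: every $\mu\in\mathcal M_{erg}$ with $h_\mu(\phi)>0$ is in the weak-$*$ closure of the set of periodic measures. - $\mathcal S$: if a sequence $(\mu_n)$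 in $\mathcal M_{inv}$ converges to $\mu$, then $\limsup_{n\to\infty}h_{\mu_n}(\phi)\le h_\mu(\phi)$. - $\mathcal F_s$: there is a dense $G_\delta$ subset of $\overline{\mathcal M_{erg}}$ (with the subspace topology) all of whose elements have support equal to $K$. Then: 1. There is a residual set $\mathcal R_1\subset C^0(K)$ such that for each $\varphi\in\mathcal R_1$ the set $\mathcal M_{max}(\varphi)$ consists of exactly one measure. 2. If the flow has the properties $\mathcal P_e^+$ and $\mathcal S$, then there is a residual set $\mathcal R_2\subset C^0(K)$ such that for each $\varphi\in\mathcal R_2$ the set $\mathcal M_{max}(\varphi)$ consists of exactly one measure, and this measure has zero metric entropy. 3. If the flow has the property $\mathcal F_s$, then there is a residual set $\mathcal R_3\subset C^0(K)$ such that for each $\varphi\in\mathcal R_3$ the set $\mathcal M_{max}(\varphi)$ consists of exactly one measure, and the support of this measure is $K$. -/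

import Mathlib

open MeasureTheory Filter Topology

namespace ErgodicOptimization

noncomputable section

/-! ### Entropy of a measure-preserving map -/

section Entropy

variable {X : Type*} [MeasurableSpace X]

/-- The Shannon entropy `H_μ(ξ) = - ∑ i, μ(ξ⁻¹{i}) log μ(ξ⁻¹{i})` of the finite partition of `X`
into the fibres of a map `ξ` with values in a finite set. -/
def partitionEntropy (μ : Measure X) {ι : Type*} [Fintype ι] (ξ : X → ι) : ℝ :=
  ∑ i, Real.negMulLog (μ.real (ξ ⁻¹' {i}))

/-- The map whose fibres form the refined partition `ξ ∨ f⁻¹ξ ∨ ⋯ ∨ f^{-(n-1)}ξ`. -/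
def itinerary (f : X → X) {ι : Type*} (ξ : X → ι) (n : ℕ) : X → (Fin n → ι) :=
  fun x i => ξ (f^[i] x)

/-- The entropy `h_μ(f, ξ)` of `f` relative to a finite partition: the limit of
`H_μ(ξ ∨ ⋯ ∨ f^{-(n-1)}ξ) / n`, which exists (by subadditivity) when `f` preserves the probability
measure `μ`; the definition takes the upper limit. -/
def entropyOfPartition (μ : Measure X) (f : X → X) {ι : Type*} [Fintype ι] (ξ : X → ι) : ENNReal :=
  limsup (fun n : ℕ => ENNReal.ofReal (partitionEntropy μ (itinerary f ξ n) / n)) atTop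

/-- The Kolmogorov-Sinai entropy `h_μ(f) ∈ [0, ∞]`: the supremum of `h_μ(f, ξ)` over all finite
measurable partitions, a partition into `k` (possibly empty) cells being given by a measurable map
to `Fin k`. -/
def mapEntropy (μ : Measure X) (f : X → X) : ENNReal :=
  ⨆ (k : ℕ) (ξ : X → Fin k) (_ : Measurable ξ), entropyOfPartition μ f ξ

end Entropy

/-! ### Invariant measures of flows -/

variable {K : Type*} [MetricSpace K] [MeasurableSpace K] [BorelSpace K]

/-- The set of invariant Borel probability measures of the flow. -/
def invariantMeasures (φ : Flow ℝ K) : Set (ProbabilityMeasure K) :=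
  {μ | ∀ t : ℝ, MeasurePreserving (φ t) (μ : Measure K) (μ : Measure K)}

/-- The set of ergodic Borel probability measures of the flow, that is, of those which are ergodic
for the action of `ℝ` on `K` given by the flow. -/
def ergodicMeasures (φ : Flow ℝ K) : Set (ProbabilityMeasure K) :=
  {μ | @ErgodicVAdd ℝ K φ.toAddAction.toVAdd _ (μ : Measure K)}

/-- The set of periodic measures: those uniformly distributed, with respect to time, along a
periodic orbit `{φ t x | 0 < t ≤ T}`, where `T > 0` and `φ T x = x`. -/
def periodicMeasures (φ : Flow ℝ K) : Set (ProbabilityMeasure K) :=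
  {μ | ∃ (x : K) (T : ℝ), 0 < T ∧ φ T x = x ∧
    (μ : Measure K) =
      ENNReal.ofReal T⁻¹ • (volume.restrict (Set.Ioc 0 T)).map (fun t : ℝ => φ t x)}

/-- The metric entropy of the flow with respect to `μ`: the entropy of its time-one map. -/
def flowEntropy (φ : Flow ℝ K) (μ : ProbabilityMeasure K) : ENNReal :=
  mapEntropy (μ : Measure K) (φ 1)

/-- `β(f)`, the supremum of `∫ f dν` over the invariant probability measures `ν` of the flow. -/
def maxIntegral (φ : Flow ℝ K) (f : C(K, ℝ)) : ℝ :=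
  sSup ((fun ν : ProbabilityMeasure K => ∫ x, f x ∂(ν : Measure K)) '' invariantMeasures φ)

/-- The set of maximizing measures of `f`. -/
def maximizingMeasures (φ : Flow ℝ K) (f : C(K, ℝ)) : Set (ProbabilityMeasure K) :=
  {μ | μ ∈ invariantMeasures φ ∧ maxIntegral φ f = ∫ x, f x ∂(μ : Measure K)}

/-- Every ergodic measure with positive metric entropy is approximated, in the weak-* topology, by
periodic measures. -/
def PropertyPePlus (φ : Flow ℝ K) : Prop :=
  ∀ μ ∈ ergodicMeasures φ, 0 < flowEntropy φ μ → μ ∈ closure (periodicMeasures φ)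

/-- The metric entropy is upper semicontinuous: if invariant measures `μs n` converge to `μ` in the
weak-* topology, then the upper limit of their entropies is at most the entropy of `μ`. -/
def PropertyS (φ : Flow ℝ K) : Prop :=
  ∀ (μs : ℕ → ProbabilityMeasure K) (μ : ProbabilityMeasure K),
    (∀ n, μs n ∈ invariantMeasures φ) → Tendsto μs atTop (𝓝 μ) →
      limsup (fun n => flowEntropy φ (μs n)) atTop ≤ flowEntropy φ μ

/-- There is a dense `Gδ` subset of the space `closure (ergodicMeasures φ)` (with its subspace
topology) all of whose elements have full support. -/
def PropertyFs (φ : Flow ℝ K) : Prop :=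
  ∃ R : Set (closure (ergodicMeasures φ)), IsGδ R ∧ Dense R ∧
    ∀ μ ∈ R, (μ.1 : Measure K).support = Set.univ

end

end ErgodicOptimization

set_option linter.unusedSectionVars false

/-! Uniqueness. If two maximizing measures of `f` give `g` integrals differing by at least `δ`, then
`f` lies in `gapSet g δ`, which is closed by compactness. Its complement is dense: along `f + t • g`
the integral of `g` against maximizing measures is monotone in `t`, so a jump of `δ` at infinitely
many `t` would exceed the bound `‖g‖`. Letting `g` run through a dense sequence and `δ = 1 / (n +
1)` gives statement 1. A unique maximizing measure is ergodic.

Statements 2 and 3 both follow from `exists_residual_unique_notMem`: the unique maximizing measure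
generically avoids closed sets `C n` whose complements are dense in the ergodic measures. Openness
is again compactness. For density, take `f` with a unique, hence ergodic, maximizing measure, and
approximate that measure by an ergodic `μ ∉ C n` that almost maximizes `f`. By
`exists_perturbation_forall_lt` a small change of `f` makes `μ` beat all of `C n`. Against one
competitor this is a Urysohn function separating `μ` from the singular part of the competitor. To
treat all competitors at once, Milman's theorem encloses them in a compact convex set without the
extreme point `μ`, and Sion's minimax theorem yields a common perturbation. For this, `integralEval`
embeds the measures in the locally convex space `C(K, ℝ) → ℝ`.

For statement 2, `C n` consists of the invariant measures of entropy at least `1 / (n + 1)`;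
periodic measures are ergodic with zero entropy and supply the density. For statement 3, the `C n`
are the complements, in the closure of the ergodic measures, of the open sets defining the given
`Gδ`. -/

namespace ErgodicOptimization

/-! ### Compact convex sets avoiding an extreme point. -/

section Convexity

variable {E : Type*} [AddCommGroup E] [Module ℝ E] [TopologicalSpace E] [IsTopologicalAddGroup E]
  [ContinuousSMul ℝ E]

theorem isCompact_convexJoin {s t : Set E} (hs : IsCompact s) (ht : IsCompact t) :
    IsCompact (convexJoin ℝ s t) := by
  have hc : IsCompact ((fun p : (E × E) × ℝ => (1 - p.2) • p.1.1 + p.2 • p.1.2) ''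
      ((s ×ˢ t) ×ˢ Set.Icc (0 : ℝ) 1)) :=
    ((hs.prod ht).prod isCompact_Icc).image (by fun_prop)
  convert! hc using 1
  ext x
  simp only [mem_convexJoin, segment_eq_image, Set.mem_image, Set.mem_prod, Prod.exists]
  constructor
  · rintro ⟨a, ha, b, hb, r, hr, h⟩
    exact ⟨a, b, r, ⟨⟨ha, hb⟩, hr⟩, h⟩
  · rintro ⟨a, b, r, ⟨⟨ha, hb⟩, hr⟩, h⟩
    exact ⟨a, ha, b, hb, r, hr, h⟩

/-- The convex join of `A` and `B` works: an extreme point on a segment with ends in `M` is one of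
the ends. Empty sets are treated apart because their convex join is empty. -/
theorem exists_compact_convex_union {M A B : Set E} {x : E} (hM : Convex ℝ M)
    (hx : x ∈ M.extremePoints ℝ)
    (hA : IsCompact A ∧ Convex ℝ A ∧ A ⊆ M ∧ x ∉ A)
    (hB : IsCompact B ∧ Convex ℝ B ∧ B ⊆ M ∧ x ∉ B) :
    ∃ D, (IsCompact D ∧ Convex ℝ D ∧ D ⊆ M ∧ x ∉ D) ∧ A ∪ B ⊆ D := by
  rcases A.eq_empty_or_nonempty with rfl | hA0
  · exact ⟨B, hB, by simp⟩
  rcases B.eq_empty_or_nonempty with rfl | hB0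
  · exact ⟨A, hA, by simp⟩
  refine ⟨convexJoin ℝ A B, ⟨isCompact_convexJoin hA.1 hB.1, hA.2.1.convexJoin hB.2.1,
    convexJoin_subset hA.2.2.1 hB.2.2.1 hM, fun h => ?_⟩,
    Set.union_subset (subset_convexJoin_left hB0) (subset_convexJoin_right hA0)⟩
  obtain ⟨a, ha, b, hb, hab⟩ := mem_convexJoin.1 h
  rcases (mem_extremePoints_iff_forall_segment.1 hx).2 a (hA.2.2.1 ha) b (hB.2.2.1 hb) hab with
    rfl | rfl
  · exact hA.2.2.2 ha
  · exact hB.2.2.2 hb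

/-- A form of Milman's theorem: a compact subset of a compact convex set `M` which does not contain
an extreme point `x` of `M` lies in a compact convex subset of `M` which does not contain `x`. -/
theorem exists_compact_convex_superset [LocallyConvexSpace ℝ E] [T2Space E] {M C : Set E} {x : E}
    (hMc : IsCompact M) (hM : Convex ℝ M) (hx : x ∈ M.extremePoints ℝ) (hC : IsCompact C)
    (hCM : C ⊆ M) (hxC : x ∉ C) :
    ∃ D, (IsCompact D ∧ Convex ℝ D ∧ D ⊆ M ∧ x ∉ D) ∧ C ⊆ D := by
  -- Compactness induction; `S` is cut with `M` because the neighbourhoods it produces need not lie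
  -- in `M`. Locally, `D` is a slice of `M` by a closed half-space that misses `x`.
  refine hC.induction_on (p := fun S => ∃ D, (IsCompact D ∧ Convex ℝ D ∧ D ⊆ M ∧ x ∉ D) ∧
    S ∩ M ⊆ D) ?_ ?_ ?_ ?_ |>.imp fun D hD => ⟨hD.1, fun y hy => hD.2 ⟨hy, hCM hy⟩⟩
  · exact ⟨∅, ⟨isCompact_empty, convex_empty, by simp, by simp⟩, by simp⟩
  · rintro s t hst ⟨D, hD, h⟩
    exact ⟨D, hD, fun y hy => h ⟨hst hy.1, hy.2⟩⟩
  · rintro s t ⟨D, hD, h⟩ ⟨D', hD', h'⟩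
    obtain ⟨D'', hD'', h''⟩ := exists_compact_convex_union hM hx hD hD'
    refine ⟨D'', hD'', fun y hy => h'' ?_⟩
    exact hy.1.imp (fun hs => h ⟨hs, hy.2⟩) (fun ht => h' ⟨ht, hy.2⟩)
  · intro y hy
    have hyx : y ≠ x := fun h => hxC (h ▸ hy)
    obtain ⟨l, hl⟩ := geometric_hahn_banach_point_point hyx
    obtain ⟨r, hr1, hr2⟩ := exists_between hl
    refine ⟨{z | l z < r}, mem_nhdsWithin_of_mem_nhds
      ((isOpen_lt l.continuous continuous_const).mem_nhds hr1), M ∩ {z | l z ≤ r},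
      ⟨hMc.inter_right (isClosed_le l.continuous continuous_const),
        hM.inter (convex_halfSpace_le l.toLinearMap.isLinear r), Set.inter_subset_left,
        fun h => not_le.2 hr2 h.2⟩, fun z hz => ⟨hz.2, show l z ≤ r from le_of_lt hz.1⟩⟩

end Convexity

/-! ### Integration functionals, invariant measures and their existence. -/

section Measures

variable {K : Type*} [MetricSpace K] [CompactSpace K] [MeasurableSpace K] [BorelSpace K]

/-- The integral of continuous functions with respect to `μ`, as a point of `C(K, ℝ) → ℝ`. -/
noncomputable def integralEval (μ : ProbabilityMeasure K) : C(K, ℝ) → ℝ :=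
  fun g => ∫ x, g x ∂(μ : Measure K)

theorem integrable_continuousMap (μ : Measure K) [IsFiniteMeasure μ] (g : C(K, ℝ)) :
    Integrable g μ :=
  g.continuous.integrable_of_hasCompactSupport (HasCompactSupport.of_compactSpace _)

theorem continuous_integralEval : Continuous (integralEval (K := K)) :=
  continuous_pi fun g =>
    ProbabilityMeasure.continuous_iff_forall_continuousMap_continuous_integral.1 continuous_id g

theorem measure_ext_of_integral {μ ν : Measure K} [IsFiniteMeasure μ] [IsFiniteMeasure ν]
    (h : ∀ g : C(K, ℝ), ∫ x, g x ∂μ = ∫ x, g x ∂ν) : μ = ν :=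
  ext_of_forall_integral_eq_of_IsFiniteMeasure fun g => h g.toContinuousMap

theorem integralEval_injective : Function.Injective (integralEval (K := K)) := fun μ ν h =>
  Subtype.ext (measure_ext_of_integral (μ := (μ : Measure K)) (ν := (ν : Measure K))
    fun g => congrFun h g)

theorem integralEval_add (μ : ProbabilityMeasure K) (f g : C(K, ℝ)) :
    integralEval μ (f + g) = integralEval μ f + integralEval μ g :=
  integral_add (integrable_continuousMap _ f) (integrable_continuousMap _ g)

theorem integralEval_smul (μ : ProbabilityMeasure K) (c : ℝ) (g : C(K, ℝ)) :
    integralEval μ (c • g) = c * integralEval μ g :=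
  integral_const_mul c g

theorem abs_integralEval_le (μ : ProbabilityMeasure K) (g : C(K, ℝ)) :
    |integralEval μ g| ≤ ‖g‖ := by
  have := norm_integral_le_of_norm_le_const (μ := (μ : Measure K)) (f := g) (C := ‖g‖)
    (Eventually.of_forall fun x => g.norm_coe_le_norm x)
  simpa [integralEval] using this

theorem abs_integralEval_sub_le (μ : ProbabilityMeasure K) (f g : C(K, ℝ)) :
    |integralEval μ f - integralEval μ g| ≤ ‖f - g‖ := by
  have h := integralEval_add μ (f - g) g
  rw [sub_add_cancel] at h
  rw [h, add_sub_cancel_right]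
  exact abs_integralEval_le μ _

theorem continuous_uncurry_integralEval :
    Continuous fun p : C(K, ℝ) × ProbabilityMeasure K => integralEval p.2 p.1 := by
  rw [continuous_iff_continuousAt]
  rintro ⟨f, μ⟩
  have h1 : Tendsto (fun p : C(K, ℝ) × ProbabilityMeasure K =>
      integralEval p.2 p.1 - integralEval p.2 f) (𝓝 (f, μ)) (𝓝 0) := by
    have h0 : Continuous fun p : C(K, ℝ) × ProbabilityMeasure K => ‖p.1 - f‖ := by fun_prop
    refine squeeze_zero_norm (fun p => abs_integralEval_sub_le p.2 p.1 f) ?_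
    simpa using h0.tendsto (f, μ)
  have h2 : Tendsto (fun p : C(K, ℝ) × ProbabilityMeasure K => integralEval p.2 f) (𝓝 (f, μ))
      (𝓝 (integralEval μ f)) :=
    (((continuous_apply f).comp continuous_integralEval).comp continuous_snd).tendsto _
  simpa [ContinuousAt] using h1.add h2

theorem continuous_integralEval_left (μ : ProbabilityMeasure K) : Continuous (integralEval μ) :=
  continuous_uncurry_integralEval.comp (by fun_prop : Continuous fun f : C(K, ℝ) => (f, μ))

theorem continuous_integralEval_right (f : C(K, ℝ)) :
    Continuous fun μ : ProbabilityMeasure K => integralEval μ f :=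
  (continuous_apply f).comp continuous_integralEval

variable (φ : Flow ℝ K)

/-- The time-`t` map of a flow precomposed with a continuous function. -/
def flowComp (t : ℝ) (g : C(K, ℝ)) : C(K, ℝ) := g.comp ⟨φ t, φ.continuous_toFun t⟩

theorem measurable_flow (t : ℝ) : Measurable (φ t) := (φ.continuous_toFun t).measurable

theorem measurePreserving_iff {μ : Measure K} [IsFiniteMeasure μ] {t : ℝ} :
    MeasurePreserving (φ t) μ μ ↔
      ∀ g : C(K, ℝ), ∫ x, g (φ t x) ∂μ = ∫ x, g x ∂μ := by
  have hm (g : C(K, ℝ)) : ∫ x, g x ∂(μ.map (φ t)) = ∫ x, g (φ t x) ∂μ :=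
    integral_map (measurable_flow φ t).aemeasurable g.continuous.aestronglyMeasurable
  constructor
  · intro h g
    rw [← hm, h.map_eq]
  · intro h
    exact ⟨measurable_flow φ t, measure_ext_of_integral fun g => by rw [hm, h]⟩

theorem mem_invariantMeasures_iff {μ : ProbabilityMeasure K} :
    μ ∈ invariantMeasures φ ↔
      ∀ t g, integralEval μ (flowComp φ t g) = integralEval μ g :=
  forall_congr' fun _ => measurePreserving_iff φ

theorem isClosed_invariantMeasures : IsClosed (invariantMeasures φ) := by
  have : invariantMeasures φ =
      ⋂ t, ⋂ g, {μ | integralEval μ (flowComp φ t g) = integralEval μ g} := by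
    ext μ
    simp [mem_invariantMeasures_iff]
  rw [this]
  exact isClosed_iInter fun t => isClosed_iInter fun g =>
    isClosed_eq (continuous_integralEval_right _) (continuous_integralEval_right _)

theorem isCompact_invariantMeasures : IsCompact (invariantMeasures φ) :=
  (isClosed_invariantMeasures φ).isCompact

theorem convex_integralEval_invariantMeasures :
    Convex ℝ (integralEval '' invariantMeasures φ) := by
  rintro _ ⟨μ, hμ, rfl⟩ _ ⟨ν, hν, rfl⟩ a b ha hb hab
  have hp : IsProbabilityMeasure
      (ENNReal.ofReal a • (μ : Measure K) + ENNReal.ofReal b • (ν : Measure K)) :=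
    ⟨by simp [← ENNReal.ofReal_add ha hb, hab]⟩
  refine ⟨⟨_, hp⟩, fun t => ?_, ?_⟩
  · refine ⟨measurable_flow φ t, ?_⟩
    simp only [ProbabilityMeasure.coe_mk]
    rw [Measure.map_add _ _ (measurable_flow φ t), Measure.map_smul, Measure.map_smul,
      (hμ t).map_eq, (hν t).map_eq]
  · ext g
    simp only [integralEval, ProbabilityMeasure.coe_mk, Pi.add_apply, Pi.smul_apply, smul_eq_mul]
    rw [integral_add_measure ((integrable_continuousMap _ g).smul_measure (by simp))
      ((integrable_continuousMap _ g).smul_measure (by simp)), integral_smul_measure,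
      integral_smul_measure, ENNReal.toReal_ofReal ha, ENNReal.toReal_ofReal hb]
    simp

/-! ### Orbit averages -/

/-- The uniform distribution, with respect to time, on the orbit segment of length `T` of `x`. -/
noncomputable def orbitMeasure (x : K) (T : ℝ) : Measure K :=
  ENNReal.ofReal T⁻¹ • (volume.restrict (Set.Ioc 0 T)).map (fun t : ℝ => φ t x)

theorem continuous_orbit (x : K) : Continuous fun t : ℝ => φ t x := by fun_prop

theorem isProbabilityMeasure_orbitMeasure (x : K) {T : ℝ} (hT : 0 < T) :
    IsProbabilityMeasure (orbitMeasure φ x T) := by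
  constructor
  rw [orbitMeasure, Measure.smul_apply, Measure.map_apply (continuous_orbit φ x).measurable
    MeasurableSet.univ]
  simp [← ENNReal.ofReal_mul (inv_nonneg.2 hT.le), inv_mul_cancel₀ hT.ne']

theorem integral_orbitMeasure (x : K) {T : ℝ} (hT : 0 < T) (g : C(K, ℝ)) :
    ∫ y, g y ∂(orbitMeasure φ x T) = T⁻¹ * ∫ t in (0 : ℝ)..T, g (φ t x) := by
  rw [orbitMeasure, integral_smul_measure, integral_map (continuous_orbit φ x).aemeasurable
    g.continuous.aestronglyMeasurable, ENNReal.toReal_ofReal (inv_nonneg.2 hT.le),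
    intervalIntegral.integral_of_le hT.le, smul_eq_mul]

/-- Shifting an orbit segment by time `t` changes only its two ends. The ends are negligible as `T →
∞`, and cancel when the orbit is `T`-periodic. -/
theorem integral_flow_orbitMeasure_sub (x : K) {T : ℝ} (hT : 0 < T) (g : C(K, ℝ)) (t : ℝ) :
    ∫ y, g (φ t y) ∂(orbitMeasure φ x T) - ∫ y, g y ∂(orbitMeasure φ x T) =
      T⁻¹ * ((∫ s in T..(T + t), g (φ s x)) - ∫ s in (0 : ℝ)..t, g (φ s x)) := by
  have hi (a b : ℝ) : IntervalIntegrable (fun s => g (φ s x)) volume a b :=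
    (g.continuous.comp (continuous_orbit φ x)).intervalIntegrable a b
  have h1 := integral_orbitMeasure φ x hT (flowComp φ t g)
  simp only [flowComp, ContinuousMap.comp_apply, ContinuousMap.coe_mk, ← φ.map_add] at h1
  rw [h1, integral_orbitMeasure φ x hT, ← mul_sub]
  congr 1
  have h2 := intervalIntegral.integral_comp_add_left (a := 0) (b := T) (fun s => g (φ s x)) t
  rw [h2, add_zero, add_comm t T]
  rw [intervalIntegral.integral_interval_sub_interval_comm (hi _ _) (hi _ _) (hi _ _)]
  rw [intervalIntegral.integral_symm t 0, intervalIntegral.integral_symm (T + t) T]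
  ring

/-- The Krylov-Bogolyubov theorem for continuous flows on compact spaces. -/
theorem invariantMeasures_nonempty [Nonempty K] : (invariantMeasures φ).Nonempty := by
  obtain ⟨x⟩ := ‹Nonempty K›
  let m : ℕ → ProbabilityMeasure K := fun n =>
    ⟨orbitMeasure φ x (n + 1), isProbabilityMeasure_orbitMeasure φ x n.cast_add_one_pos⟩
  obtain ⟨μ, k, hk, hμ⟩ := CompactSpace.tendsto_subseq m
  refine ⟨μ, (mem_invariantMeasures_iff φ).2 fun t g => ?_⟩
  have h1 := (((continuous_integralEval_right (flowComp φ t g)).tendsto μ).comp hμ).sub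
    (((continuous_integralEval_right g).tendsto μ).comp hμ)
  refine sub_eq_zero.1 (tendsto_nhds_unique h1 ?_)
  have h2 : Tendsto (fun n : ℕ => 1 / ((n : ℝ) + 1) * (2 * (‖g‖ * |t|))) atTop (𝓝 0) := by
    simpa using (tendsto_one_div_add_atTop_nhds_zero_nat (𝕜 := ℝ)).mul_const (2 * (‖g‖ * |t|))
  refine squeeze_zero_norm (fun n => ?_) (h2.comp hk.tendsto_atTop)
  have hpos : (0 : ℝ) < (k n : ℝ) + 1 := (k n).cast_add_one_pos
  have h3 := integral_flow_orbitMeasure_sub φ x hpos g t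
  have hb (a b : ℝ) : |∫ s in a..b, g (φ s x)| ≤ ‖g‖ * |b - a| :=
    intervalIntegral.norm_integral_le_of_norm_le_const fun s _ => g.norm_coe_le_norm _
  have hb1 := hb 0 t
  have hb2 := hb ((k n : ℝ) + 1) (k n + 1 + t)
  rw [sub_zero] at hb1
  rw [add_sub_cancel_left] at hb2
  change |∫ y, g (φ t y) ∂(orbitMeasure φ x ((k n : ℝ) + 1)) -
    ∫ y, g y ∂(orbitMeasure φ x ((k n : ℝ) + 1))| ≤ 1 / ((k n : ℝ) + 1) * _
  rw [h3, abs_mul, abs_of_pos (inv_pos.2 hpos), one_div]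
  refine mul_le_mul_of_nonneg_left ?_ (inv_pos.2 hpos).le
  refine (abs_sub _ _).trans ?_
  linarith

end Measures

/-! ### Extremality of ergodic measures and perturbations in their favour. -/

section ErgodicDecomposition

variable {K : Type*} [MetricSpace K] [CompactSpace K] [MeasurableSpace K] [BorelSpace K]
  {φ : Flow ℝ K}

theorem mem_ergodicMeasures_iff {μ : ProbabilityMeasure K} :
    μ ∈ ergodicMeasures φ ↔ μ ∈ invariantMeasures φ ∧ ∀ s : Set K, MeasurableSet s →
      (∀ t, φ t ⁻¹' s =ᵐ[(μ : Measure K)] s) → EventuallyConst s (ae (μ : Measure K)) := by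
  constructor
  · intro h
    refine ⟨fun t => ⟨measurable_flow φ t, ?_⟩, fun s hs hst => ?_⟩
    · ext s hs
      rw [Measure.map_apply (measurable_flow φ t) hs]
      exact h.1.1 t hs
    · exact h.2 hs hst
  · rintro ⟨h1, h2⟩
    exact @ErgodicVAdd.mk ℝ K φ.toAddAction.toVAdd _ _
      (@VAddInvariantMeasure.mk ℝ K φ.toAddAction.toVAdd _ _
        fun t s hs => (h1 t).measure_preimage hs.nullMeasurableSet) (fun {s} hs hst => h2 s hs hst)

theorem ergodicMeasures_subset : ergodicMeasures φ ⊆ invariantMeasures φ := fun _ h =>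
  (mem_ergodicMeasures_iff.1 h).1

/-- The density is flow-invariant, hence almost everywhere constant. Finite `ν` are allowed so that
this applies to the absolutely continuous part of an invariant measure. -/
theorem eq_smul_of_absolutelyContinuous {μ : ProbabilityMeasure K} (hμ : μ ∈ ergodicMeasures φ)
    {ν : Measure K} [IsFiniteMeasure ν] (hν : ∀ t, MeasurePreserving (φ t) ν ν)
    (h : ν ≪ (μ : Measure K)) : ∃ c : ENNReal, ν = c • (μ : Measure K) := by
  rw [mem_ergodicMeasures_iff] at hμ
  obtain ⟨c, hc⟩ : ∃ c, ν.rnDeriv μ =ᵐ[(μ : Measure K)] Function.const K c := by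
    refine exists_eventuallyEq_const_of_forall_separating MeasurableSet fun U hU => ?_
    refine eventuallyConst_set.1 (hμ.2 (ν.rnDeriv μ ⁻¹' U) (Measure.measurable_rnDeriv _ _ hU)
      fun t => ?_)
    have := (hν t).rnDeriv_comp_aeEq (hμ.1 t)
    refine (this.mono fun x hx => ?_).set_eq
    rw [← Set.preimage_comp, Set.mem_preimage, Set.mem_preimage, hx]
  refine ⟨c, ?_⟩
  ext s hs
  calc
    ν s = ∫⁻ a in s, ν.rnDeriv μ a ∂(μ : Measure K) := (Measure.setLIntegral_rnDeriv h _).symm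
    _ = ∫⁻ _ in s, c ∂(μ : Measure K) :=
      lintegral_congr_ae <| hc.filter_mono <| ae_mono Measure.restrict_le_self
    _ = (c • (μ : Measure K)) s := by simp

theorem eq_of_absolutelyContinuous {μ ν : ProbabilityMeasure K} (hμ : μ ∈ ergodicMeasures φ)
    (hν : ν ∈ invariantMeasures φ) (h : (ν : Measure K) ≪ (μ : Measure K)) : ν = μ := by
  obtain ⟨c, hc⟩ := eq_smul_of_absolutelyContinuous hμ hν h
  have h1 := congrArg (fun m : Measure K => m Set.univ) hc
  simp only [measure_univ, Measure.smul_apply, smul_eq_mul, mul_one] at h1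
  refine Subtype.ext ?_
  rw [← h1, one_smul] at hc
  exact hc

/-- The measure underlying a convex combination of integration functionals. -/
theorem coe_eq_smul_add_smul {μ ν ρ : ProbabilityMeasure K} {a b : ℝ} (ha : 0 ≤ a) (hb : 0 ≤ b)
    (h : a • integralEval ν + b • integralEval ρ = integralEval μ) :
    (μ : Measure K) =
      ENNReal.ofReal a • (ν : Measure K) + ENNReal.ofReal b • (ρ : Measure K) := by
  have hf1 : IsFiniteMeasure (ENNReal.ofReal a • (ν : Measure K)) :=
    Measure.smul_finite _ ENNReal.ofReal_ne_top
  have hf2 : IsFiniteMeasure (ENNReal.ofReal b • (ρ : Measure K)) :=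
    Measure.smul_finite _ ENNReal.ofReal_ne_top
  refine measure_ext_of_integral fun g => ?_
  rw [integral_add_measure (integrable_continuousMap _ g) (integrable_continuousMap _ g),
    integral_smul_measure, integral_smul_measure, ENNReal.toReal_ofReal ha,
    ENNReal.toReal_ofReal hb]
  exact (congrFun h g).symm

/-- A component of positive weight in a mixture equal to `μ` is absolutely continuous with respect
to `μ`, hence equal to it. -/
theorem integralEval_mem_extremePoints {μ : ProbabilityMeasure K} (hμ : μ ∈ ergodicMeasures φ) :
    integralEval μ ∈ (integralEval '' invariantMeasures φ).extremePoints ℝ := by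
  rw [mem_extremePoints_iff_left]
  refine ⟨⟨μ, ergodicMeasures_subset hμ, rfl⟩, ?_⟩
  rintro _ ⟨ν, hν, rfl⟩ _ ⟨ρ, -, rfl⟩ ⟨a, b, ha, hb, -, h⟩
  congr 1
  refine eq_of_absolutelyContinuous hμ hν ?_
  rw [coe_eq_smul_add_smul ha.le hb.le h]
  refine .add_right ?_ _
  exact Measure.absolutelyContinuous_smul (ENNReal.ofReal_pos.2 ha).ne'

/-- The bound 1 is what lets `ε • g` outweigh a defect of size `ε`. Take `2u - 1` with `u` a Urysohn
function of closed sets of mass above `9 / 10`: then `∫ u dμ > 8 / 10` and `∫ u dν < 1 / 10`, so the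
difference exceeds `14 / 10`. -/
theorem exists_integralEval_sub_gt_one {μ ν : ProbabilityMeasure K}
    (h : (μ : Measure K).MutuallySingular ν) :
    ∃ g : C(K, ℝ), ‖g‖ ≤ 1 ∧ 1 < integralEval μ g - integralEval ν g := by
  obtain ⟨s, hs, hμ, hν⟩ := h
  have key (m : ProbabilityMeasure K) (t : Set K) (ht : MeasurableSet t)
      (hm : (m : Measure K) tᶜ = 0) : ∃ F ⊆ t, IsClosed F ∧ 9 / 10 < (m : Measure K).real F := by
    have h1 : (m : Measure K) t = 1 := (prob_compl_eq_zero_iff ht).1 hm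
    obtain ⟨F, hF, hFc, h2⟩ := ht.exists_isClosed_lt_add (μ := (m : Measure K)) (by simp)
      (ε := ENNReal.ofReal (1 / 10)) (by simp)
    refine ⟨F, hF, hFc, ?_⟩
    rw [h1, ← ofReal_measureReal, ← ENNReal.ofReal_add measureReal_nonneg (by norm_num),
      ENNReal.one_lt_ofReal] at h2
    linarith
  obtain ⟨A, hA, hAc, hμA⟩ := key μ sᶜ hs.compl (by simpa using hμ)
  obtain ⟨B, hB, hBc, hνB⟩ := key ν s hs hν
  have hd : Disjoint B A := (disjoint_compl_right.mono hB hA)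
  obtain ⟨u, huB, huA, hu⟩ := exists_continuous_zero_one_of_isClosed hBc hAc hd
  have hsplit (m : ProbabilityMeasure K) (F : Set K) (hF : IsClosed F) (c : ℝ)
      (hc : ∀ x ∈ F, u x = c) : |integralEval m u - c * (m : Measure K).real F| ≤
        1 - (m : Measure K).real F := by
    have h1 := integral_add_compl hF.measurableSet (integrable_continuousMap (m : Measure K) u)
    rw [setIntegral_congr_fun hF.measurableSet hc, setIntegral_const, smul_eq_mul] at h1
    rw [integralEval, ← h1, mul_comm, add_sub_cancel_left]
    have h2 := norm_setIntegral_le_of_norm_le_const (μ := (m : Measure K)) (s := Fᶜ) (f := u)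
      (C := 1) (measure_lt_top _ _) (fun x _ => by
        rw [Real.norm_eq_abs, abs_le]; constructor <;> linarith [(hu x).1, (hu x).2])
    rw [probReal_compl_eq_one_sub hF.measurableSet, one_mul] at h2
    exact h2
  have hμu := abs_le.1 (hsplit μ A hAc 1 huA)
  have hνu := abs_le.1 (hsplit ν B hBc 0 huB)
  refine ⟨(2 : ℝ) • u - 1, ?_, ?_⟩
  · refine (ContinuousMap.norm_le _ zero_le_one).2 fun x => ?_
    rw [Real.norm_eq_abs, abs_le]
    simp only [ContinuousMap.sub_apply, ContinuousMap.smul_apply, smul_eq_mul,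
      ContinuousMap.one_apply]
    constructor <;> linarith [(hu x).1, (hu x).2]
  · have h1 (m : ProbabilityMeasure K) :
        integralEval m ((2 : ℝ) • u - 1) = 2 * integralEval m u - 1 := by
      have h := integralEval_add m ((2 : ℝ) • u - 1) 1
      rw [sub_add_cancel, integralEval_smul] at h
      have h' : integralEval m 1 = 1 := by simp [integralEval]
      linarith
    rw [h1, h1]
    linarith

/-- An invariant probability measure other than the ergodic measure `μ` is a mixture of `μ` and of
an invariant probability measure which is singular to `μ`. -/
theorem exists_mutuallySingular_decomposition {μ ν : ProbabilityMeasure K}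
    (hμ : μ ∈ ergodicMeasures φ) (hν : ν ∈ invariantMeasures φ) (hne : ν ≠ μ) :
    ∃ ρ ∈ invariantMeasures φ, (μ : Measure K).MutuallySingular ρ ∧ ∃ m : ℝ, 0 < m ∧
      ∀ g, integralEval ν g - integralEval μ g = m * (integralEval ρ g - integralEval μ g) := by
  have hμi := ergodicMeasures_subset hμ
  set σ : Measure K := (ν : Measure K).singularPart μ with hσ
  have hadd := Measure.singularPart_add_rnDeriv (ν : Measure K) (μ : Measure K)
  -- Both Lebesgue parts of `ν` are invariant, so the absolutely continuous one is a multiple of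
  -- `μ`. The singular part is nonzero since `ν ≠ μ`; normalized it is `ρ`, and `m` is its mass.
  obtain ⟨c, hc⟩ := eq_smul_of_absolutelyContinuous hμ
    (ν := (μ : Measure K).withDensity ((ν : Measure K).rnDeriv μ))
    (fun t => (hν t).withDensity_rnDeriv (hμi t)) (withDensity_absolutelyContinuous _ _)
  rw [hc, ← hσ] at hadd
  have hσ0 : σ ≠ 0 := by
    intro h0
    rw [h0, zero_add] at hadd
    refine hne (eq_of_absolutelyContinuous hμ hν ?_)
    rw [← hadd]
    exact Measure.smul_absolutelyContinuous
  have hm0 : σ Set.univ ≠ 0 := by simpa using hσ0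
  have hmt : σ Set.univ ≠ ⊤ := measure_ne_top _ _
  have hp : IsProbabilityMeasure ((σ Set.univ)⁻¹ • σ) :=
    ⟨by simp [ENNReal.inv_mul_cancel hm0 hmt]⟩
  refine ⟨⟨_, hp⟩, fun t => ((hν t).singularPart (hμi t)).smul_measure _, ?_,
    (σ Set.univ).toReal, ENNReal.toReal_pos hm0 hmt, fun g => ?_⟩
  · exact ((Measure.mutuallySingular_singularPart _ _).smul _).symm
  · have hmass := congrArg (fun m : Measure K => m Set.univ) hadd
    simp only [Measure.add_apply, measure_univ, Measure.smul_apply, smul_eq_mul, mul_one] at hmass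
    have hct : c ≠ ⊤ := fun h => by simp [h] at hmass
    have hmass' : (σ Set.univ).toReal + c.toReal = 1 := by
      rw [← ENNReal.toReal_add hmt hct, hmass, ENNReal.toReal_one]
    have hf : IsFiniteMeasure (c • (μ : Measure K)) := Measure.smul_finite _ hct
    have h1 : integralEval ν g = ∫ x, g x ∂σ + c.toReal * integralEval μ g := by
      rw [integralEval, ← hadd, integral_add_measure (integrable_continuousMap _ g)
        (integrable_continuousMap _ g), integral_smul_measure]
      rfl
    have h2 : ∫ x, g x ∂σ = (σ Set.univ).toReal * integralEval ⟨_, hp⟩ g := by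
      have : integralEval ⟨_, hp⟩ g = ∫ x, g x ∂((σ Set.univ)⁻¹ • σ) := rfl
      rw [this, integral_smul_measure, ENNReal.toReal_inv, smul_eq_mul,
        mul_inv_cancel_left₀ (ENNReal.toReal_pos hm0 hmt).ne']
    rw [h1, h2]
    linear_combination integralEval μ g * hmass'

theorem exists_perturbation_lt {μ ν : ProbabilityMeasure K}
    (hμ : μ ∈ ergodicMeasures φ) (hν : ν ∈ invariantMeasures φ) (hne : ν ≠ μ) {f : C(K, ℝ)}
    {ε : ℝ} (hε : 0 < ε)
    (hf : ∀ ρ ∈ invariantMeasures φ, integralEval ρ f ≤ integralEval μ f + ε) :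
    ∃ h : C(K, ℝ), ‖h‖ ≤ ε ∧ integralEval ν (f + h) < integralEval μ (f + h) := by
  obtain ⟨ρ, hρ, hs, m, hm, hd⟩ := exists_mutuallySingular_decomposition hμ hν hne
  obtain ⟨g, hg, hg1⟩ := exists_integralEval_sub_gt_one hs
  refine ⟨ε • g, ?_, ?_⟩
  · rw [norm_smul, Real.norm_of_nonneg hε.le]
    exact mul_le_of_le_one_right hε.le hg
  · rw [← sub_neg, hd]
    refine mul_neg_of_pos_of_neg hm ?_
    simp only [integralEval_add, integralEval_smul]
    nlinarith [hf ρ hρ]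

/-- If an ergodic measure almost maximizes `f`, then it beats all measures of a given compact set
of other invariant measures after a small perturbation of `f`. -/
theorem exists_perturbation_forall_lt {μ : ProbabilityMeasure K} (hμ : μ ∈ ergodicMeasures φ)
    {C : Set (ProbabilityMeasure K)} (hC : IsClosed C) (hCi : C ⊆ invariantMeasures φ)
    (hμC : μ ∉ C) {f : C(K, ℝ)} {ε : ℝ} (hε : 0 < ε)
    (hf : ∀ ρ ∈ invariantMeasures φ, integralEval ρ f ≤ integralEval μ f + ε) :
    ∃ h : C(K, ℝ), ‖h‖ ≤ ε ∧
      ∀ ν ∈ C, integralEval ν (f + h) < integralEval μ (f + h) := by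
  obtain ⟨D, ⟨hDc, hD, hDM, hμD⟩, hCD⟩ := exists_compact_convex_superset
    ((isCompact_invariantMeasures φ).image continuous_integralEval)
    (convex_integralEval_invariantMeasures φ) (integralEval_mem_extremePoints hμ)
    (hC.isCompact.image continuous_integralEval) (Set.image_mono hCi)
    (by rwa [integralEval_injective.mem_set_image])
  rcases D.eq_empty_or_nonempty with rfl | hne
  · exact ⟨0, by simpa using hε.le, fun ν hν => (hCD ⟨ν, hν, rfl⟩).elim⟩
  -- The advantage of `μ` over `w` after perturbing by `h`: affine in `w`, and on `D` also affine in
  -- `h`.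
  let F : (C(K, ℝ) → ℝ) → C(K, ℝ) → ℝ := fun w h => integralEval μ (f + h) - w (f + h)
  have hcont (h : C(K, ℝ)) : Continuous fun w => F w h := by fun_prop
  have hloc : ∀ w ∈ D, ∃ h ∈ Metric.closedBall (0 : C(K, ℝ)) ε, 0 < F w h := by
    intro w hw
    obtain ⟨ν, hν, rfl⟩ := hDM hw
    obtain ⟨h, h1, h2⟩ := exists_perturbation_lt hμ hν (fun h => hμD (h ▸ hw)) hε hf
    exact ⟨h, by simpa using h1, sub_pos.2 h2⟩
  choose! H hH hH0 using hloc
  obtain ⟨T, hTD, hT⟩ := hDc.elim_nhds_subcover (fun w => {v | 0 < F v (H w)}) fun w hw =>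
    (isOpen_lt continuous_const (hcont _)).mem_nhds (hH0 w hw)
  have hsum (ν : ProbabilityMeasure K) (h h' : C(K, ℝ)) (a b : ℝ) (hab : a + b = 1) :
      integralEval ν (f + (a • h + b • h')) =
        a * integralEval ν (f + h) + b * integralEval ν (f + h') := by
    simp only [integralEval_add, integralEval_smul]
    linear_combination -integralEval ν f * hab
  -- Minimax exchanges the quantifiers: each `w ∈ D` is beaten by one of finitely many `H v`, so a
  -- single `h` in the ball beats every `w ∈ D`.
  obtain ⟨h, hh, hlt⟩ := Sion.exists_lt_iInf_of_lt_iInf_of_finite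
    (X := D) (Y := Metric.closedBall (0 : C(K, ℝ)) ε) (f := F) hne hDc
    (fun h _ => (hcont h).lowerSemicontinuous.lowerSemicontinuousOn D)
    (fun h _ => by
      refine ConvexOn.quasiconvexOn ⟨hD, fun v _ w _ a b _ _ hab => le_of_eq ?_⟩
      simp only [F, Pi.add_apply, Pi.smul_apply, smul_eq_mul]
      linear_combination -integralEval μ (f + h) * hab)
    (convex_closedBall 0 ε)
    (fun w hw => by
      obtain ⟨ν, hν, rfl⟩ := hDM hw
      exact (((continuous_integralEval_left μ).comp (continuous_const_add f)).sub
        ((continuous_integralEval_left ν).comp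
          (continuous_const_add f))).upperSemicontinuous.upperSemicontinuousOn _)
    (fun w hw => by
      obtain ⟨ν, hν, rfl⟩ := hDM hw
      refine ConcaveOn.quasiconcaveOn ⟨convex_closedBall 0 ε,
        fun h _ h' _ a b _ _ hab => le_of_eq ?_⟩
      simp only [F, hsum _ h h' a b hab, smul_eq_mul]
      ring)
    hD (T.finite_toSet.image H) (t := 0)
    (by rintro _ ⟨w, hw, rfl⟩; exact hH w (hTD w hw))
    (fun w hw => by
      obtain ⟨v, hv, hvw⟩ := Set.mem_iUnion₂.1 (hT hw)
      exact ⟨H v, ⟨v, hv, rfl⟩, hvw⟩)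
  exact ⟨h, by simpa using hh, fun ν hν => sub_pos.1 (hlt _ (hCD ⟨ν, hν, rfl⟩))⟩

end ErgodicDecomposition

/-! ### Residual sets of functions with a unique maximizing measure. -/

section Generic

variable {K : Type*} [MetricSpace K] [CompactSpace K] [MeasurableSpace K] [BorelSpace K]
  (φ : Flow ℝ K)

theorem integralEval_le_maxIntegral {ν : ProbabilityMeasure K} (hν : ν ∈ invariantMeasures φ)
    (f : C(K, ℝ)) : integralEval ν f ≤ maxIntegral φ f :=
  le_csSup ⟨‖f‖, by
    rintro _ ⟨μ, -, rfl⟩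
    exact (le_abs_self _).trans (abs_integralEval_le μ f)⟩ ⟨ν, hν, rfl⟩

theorem mem_maximizingMeasures_iff {μ : ProbabilityMeasure K} {f : C(K, ℝ)} :
    μ ∈ maximizingMeasures φ f ↔
      μ ∈ invariantMeasures φ ∧ ∀ ν ∈ invariantMeasures φ, integralEval ν f ≤ integralEval μ f := by
  constructor
  · rintro ⟨h1, h2⟩
    refine ⟨h1, fun ν hν => (integralEval_le_maxIntegral φ hν f).trans_eq h2⟩
  · rintro ⟨h1, h2⟩
    refine ⟨h1, le_antisymm (csSup_le ⟨_, μ, h1, rfl⟩ ?_) (integralEval_le_maxIntegral φ h1 f)⟩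
    rintro _ ⟨ν, hν, rfl⟩
    exact h2 ν hν

theorem maximizingMeasures_nonempty [Nonempty K] (f : C(K, ℝ)) :
    (maximizingMeasures φ f).Nonempty := by
  obtain ⟨μ, hμ, h⟩ := (isCompact_invariantMeasures φ).exists_isMaxOn
    (invariantMeasures_nonempty φ) (continuous_integralEval_right f).continuousOn
  exact ⟨μ, (mem_maximizingMeasures_iff φ).2 ⟨hμ, fun ν hν => h hν⟩⟩

theorem isClosed_maximizingMeasures_graph :
    IsClosed {p : C(K, ℝ) × ProbabilityMeasure K | p.2 ∈ maximizingMeasures φ p.1} := by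
  have : {p : C(K, ℝ) × ProbabilityMeasure K | p.2 ∈ maximizingMeasures φ p.1} =
      Prod.snd ⁻¹' invariantMeasures φ ∩ ⋂ ν ∈ invariantMeasures φ,
        {p | integralEval ν p.1 ≤ integralEval p.2 p.1} := by
    ext p
    simp [mem_maximizingMeasures_iff]
  rw [this]
  exact ((isClosed_invariantMeasures φ).preimage continuous_snd).inter
    (isClosed_biInter fun ν _ => isClosed_le
      ((continuous_integralEval_left ν).comp continuous_fst) continuous_uncurry_integralEval)

/-- Uniqueness of the maximizing measure implies its ergodicity. -/
theorem mem_ergodicMeasures_of_maximizingMeasures_eq {f : C(K, ℝ)} {μ : ProbabilityMeasure K}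
    (h : maximizingMeasures φ f = {μ}) : μ ∈ ergodicMeasures φ := by
  have hμ : μ ∈ maximizingMeasures φ f := h ▸ rfl
  rw [mem_maximizingMeasures_iff] at hμ
  refine mem_ergodicMeasures_iff.2 ⟨hμ.1, fun s hs hst => ?_⟩
  by_contra hcon
  obtain ⟨h1, h2⟩ : (μ : Measure K) s ≠ 0 ∧ (μ : Measure K) sᶜ ≠ 0 := by
    simpa [eventuallyConst_set, ae_iff, and_comm] using! hcon
  have hinv (t : Set K) (ht : MeasurableSet t) (htt : ∀ r, φ r ⁻¹' t =ᵐ[(μ : Measure K)] t)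
      (ht0 : (μ : Measure K) t ≠ 0) : ∃ ν ∈ invariantMeasures φ,
        (ν : Measure K) = ((μ : Measure K) t)⁻¹ • (μ : Measure K).restrict t := by
    refine ⟨⟨ProbabilityTheory.cond μ t, ProbabilityTheory.cond_isProbabilityMeasure ht0⟩,
      fun r => ?_, rfl⟩
    refine MeasurePreserving.smul_measure ?_ _
    have := (hμ.1 r).restrict_preimage ht
    rwa [Measure.restrict_congr_set (htt r)] at this
  obtain ⟨ν, hν, hνe⟩ := hinv s hs hst h1
  obtain ⟨ρ, hρ, hρe⟩ := hinv sᶜ hs.compl (fun r => (hst r).compl) h2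
  have hsum : integralEval μ f = (μ : Measure K).real s * integralEval ν f +
      (μ : Measure K).real sᶜ * integralEval ρ f := by
    simp only [integralEval]
    rw [← integral_add_compl hs (integrable_continuousMap _ f), hνe, hρe, integral_smul_measure,
      integral_smul_measure, ENNReal.toReal_inv, ENNReal.toReal_inv, smul_eq_mul, smul_eq_mul]
    rw [measureReal_def, measureReal_def, mul_inv_cancel_left₀, mul_inv_cancel_left₀]
    · exact (ENNReal.toReal_pos h2 (measure_ne_top _ _)).ne'
    · exact (ENNReal.toReal_pos h1 (measure_ne_top _ _)).ne'
  have hp1 : 0 < (μ : Measure K).real s := ENNReal.toReal_pos h1 (measure_ne_top _ _)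
  have hp2 : 0 < (μ : Measure K).real sᶜ := ENNReal.toReal_pos h2 (measure_ne_top _ _)
  have hp3 : (μ : Measure K).real s + (μ : Measure K).real sᶜ = 1 := by
    rw [measureReal_add_measureReal_compl hs, probReal_univ]
  -- `μ` is a mixture, with positive weights, of its conditional measures on `s` and `sᶜ`, so both
  -- must maximize. Uniqueness forces `ν = μ`, although `ν` does not charge `sᶜ`.
  have hνmax : ν ∈ maximizingMeasures φ f := by
    refine (mem_maximizingMeasures_iff φ).2 ⟨hν, fun τ hτ => (hμ.2 τ hτ).trans ?_⟩
    by_contra! hlt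
    have h3 := mul_pos hp1 (sub_pos.2 hlt)
    have h4 := mul_nonneg hp2.le (sub_nonneg.2 (hμ.2 ρ hρ))
    have h5 : integralEval μ f =
      ((μ : Measure K).real s + (μ : Measure K).real sᶜ) * integralEval μ f := by rw [hp3, one_mul]
    linarith
  rw [h, Set.mem_singleton_iff] at hνmax
  rw [hνmax] at hνe
  refine h2 ?_
  rw [hνe, Measure.smul_apply, Measure.restrict_apply hs.compl]
  simp

/-- The functions having two maximizing measures whose integrals of `g` differ by at least `δ`. -/
def gapSet (g : C(K, ℝ)) (δ : ℝ) : Set C(K, ℝ) :=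
  {f | ∃ μ ∈ maximizingMeasures φ f, ∃ ν ∈ maximizingMeasures φ f,
    integralEval μ g + δ ≤ integralEval ν g}

/-- Projection of a closed set along the compact space of pairs of measures. The non-strict
inequality in `gapSet` is essential. -/
theorem isClosed_gapSet (g : C(K, ℝ)) (δ : ℝ) : IsClosed (gapSet φ g δ) := by
  have hG := isClosed_maximizingMeasures_graph φ
  have : gapSet φ g δ = Prod.fst ''
      {p : C(K, ℝ) × (ProbabilityMeasure K × ProbabilityMeasure K) |
        (p.2.1 ∈ maximizingMeasures φ p.1 ∧ p.2.2 ∈ maximizingMeasures φ p.1) ∧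
          integralEval p.2.1 g + δ ≤ integralEval p.2.2 g} := by
    ext f
    simp only [gapSet, Set.mem_ofPred_eq, Set.mem_image, Prod.exists, exists_and_right,
      exists_eq_right]
    constructor
    · rintro ⟨μ, hμ, ν, hν, h⟩
      exact ⟨μ, ν, ⟨hμ, hν⟩, h⟩
    · rintro ⟨μ, ν, ⟨hμ, hν⟩, h⟩
      exact ⟨μ, hμ, ν, hν, h⟩
  rw [this]
  refine isClosedMap_fst_of_compactSpace _ (IsClosed.inter (IsClosed.inter ?_ ?_) ?_)
  · exact hG.preimage (f := fun p : C(K, ℝ) × (ProbabilityMeasure K × ProbabilityMeasure K) =>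
      (p.1, p.2.1)) (by fun_prop)
  · exact hG.preimage (f := fun p : C(K, ℝ) × (ProbabilityMeasure K × ProbabilityMeasure K) =>
      (p.1, p.2.2)) (by fun_prop)
  · exact isClosed_le (((continuous_integralEval_right g).comp
      (continuous_fst.comp continuous_snd)).add continuous_const)
      ((continuous_integralEval_right g).comp (continuous_snd.comp continuous_snd))

/-- The integral of `g` with respect to maximizing measures of `f + t • g` increases with `t`. -/
theorem integralEval_mono_of_maximizing {f g : C(K, ℝ)} {s t : ℝ} (hst : s < t)
    {μ ν : ProbabilityMeasure K} (hμ : μ ∈ maximizingMeasures φ (f + s • g))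
    (hν : ν ∈ maximizingMeasures φ (f + t • g)) : integralEval μ g ≤ integralEval ν g := by
  rw [mem_maximizingMeasures_iff] at hμ hν
  have h1 := hμ.2 ν hν.1
  have h2 := hν.2 μ hμ.1
  simp only [integralEval_add, integralEval_smul] at h1 h2
  by_contra! h
  nlinarith

theorem dense_compl_gapSet (g : C(K, ℝ)) {δ : ℝ} (hδ : 0 < δ) : Dense (gapSet φ g δ)ᶜ := by
  intro f
  rw [Metric.mem_closure_iff]
  intro ε hε
  by_contra! hcon
  set η : ℝ := ε / (‖g‖ + 1) with hη
  have hηpos : 0 < η := by positivity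
  -- Increasing in `[0, η)`, with `η * ‖g‖ < ε`, so every `f + t n • g` is within `ε` of `f`. The
  -- gap at `t n` and monotonicity up to `t (n + 1)` raise the integral of `g` by `δ` at each step.
  let t : ℕ → ℝ := fun n => η * (1 - 1 / ((n : ℝ) + 1))
  have hts : ∀ n, t n < t (n + 1) := fun n => by
    refine mul_lt_mul_of_pos_left (sub_lt_sub_left ?_ _) hηpos
    exact one_div_lt_one_div_of_lt (by positivity) (by push_cast; linarith)
  have hmem : ∀ n, f + t n • g ∈ gapSet φ g δ := by
    intro n
    by_contra hn
    have h1 := hcon _ hn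
    rw [dist_eq_norm, sub_add_cancel_left, norm_neg, norm_smul, Real.norm_eq_abs] at h1
    have hn1 : 1 / ((n : ℝ) + 1) ≤ 1 := by
      rw [div_le_one (by positivity)]
      linarith [n.cast_nonneg (α := ℝ)]
    have hn0 : 0 < 1 / ((n : ℝ) + 1) := by positivity
    have h2 : |t n| ≤ η := by
      rw [abs_of_nonneg (mul_nonneg hηpos.le (by linarith))]
      exact mul_le_of_le_one_right hηpos.le (by linarith)
    have h3 : η * (‖g‖ + 1) = ε := div_mul_cancel₀ _ (by positivity)
    nlinarith [norm_nonneg g]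
  choose μ hμ ν hν hgap using hmem
  have hgrow : ∀ n : ℕ, -‖g‖ + n * δ ≤ integralEval (μ n) g := by
    intro n
    induction n with
    | zero => simpa using (abs_le.1 (abs_integralEval_le (μ 0) g)).1
    | succ n ih =>
      have h1 := integralEval_mono_of_maximizing φ (hts n) (hν n) (hμ (n + 1))
      have h2 := hgap n
      push_cast
      linarith
  obtain ⟨n, hn⟩ := exists_nat_gt (2 * ‖g‖ / δ)
  rw [div_lt_iff₀ hδ] at hn
  linarith [hgrow n, (abs_le.1 (abs_integralEval_le (μ n) g)).2]

/-- A residual set of functions which have a unique maximizing measure. -/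
theorem exists_residual_unique [Nonempty K] :
    ∃ R : Set C(K, ℝ), IsGδ R ∧ Dense R ∧
      ∀ f ∈ R, ∃ μ : ProbabilityMeasure K, maximizingMeasures φ f = {μ} := by
  let d := TopologicalSpace.denseSeq C(K, ℝ)
  have hopen : ∀ p : ℕ × ℕ, IsOpen (gapSet φ (d p.1) (1 / ((p.2 : ℝ) + 1)))ᶜ := fun p =>
    (isClosed_gapSet φ _ _).isOpen_compl
  refine ⟨⋂ p : ℕ × ℕ, (gapSet φ (d p.1) (1 / ((p.2 : ℝ) + 1)))ᶜ,
    .iInter_of_isOpen hopen, dense_iInter_of_isOpen hopen fun p =>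
      dense_compl_gapSet φ _ (by positivity), fun f hf => ?_⟩
  obtain ⟨μ, hμ⟩ := maximizingMeasures_nonempty φ f
  refine ⟨μ, Set.eq_singleton_iff_unique_mem.2 ⟨hμ, fun ν hν => ?_⟩⟩
  by_contra hne
  have key : ∀ k, integralEval ν (d k) = integralEval μ (d k) := by
    intro k
    by_contra hk
    have hlt : ∀ {α β : ProbabilityMeasure K}, α ∈ maximizingMeasures φ f →
        β ∈ maximizingMeasures φ f → ¬ integralEval α (d k) < integralEval β (d k) := by
      intro α β hα hβ h
      obtain ⟨n, hn⟩ := exists_nat_one_div_lt (sub_pos.2 h)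
      exact Set.mem_iInter.1 hf (k, n) ⟨α, hα, β, hβ, by dsimp only; linarith⟩
    rcases lt_or_gt_of_ne hk with h | h
    · exact hlt hν hμ h
    · exact hlt hμ hν h
  refine hne (integralEval_injective ?_)
  exact Continuous.ext_on (TopologicalSpace.denseRange_denseSeq C(K, ℝ))
    (continuous_integralEval_left ν) (continuous_integralEval_left μ)
    (by rintro _ ⟨k, rfl⟩; exact key k)

theorem isOpen_disjoint_maximizingMeasures {C : Set (ProbabilityMeasure K)} (hC : IsClosed C) :
    IsOpen {f : C(K, ℝ) | Disjoint (maximizingMeasures φ f) C} := by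
  have : {f : C(K, ℝ) | Disjoint (maximizingMeasures φ f) C} = (Prod.fst ''
      ({p : C(K, ℝ) × ProbabilityMeasure K | p.2 ∈ maximizingMeasures φ p.1} ∩
        Prod.snd ⁻¹' C))ᶜ := by
    ext f
    simp [Set.disjoint_left]
  rw [this]
  exact (isClosedMap_fst_of_compactSpace _ ((isClosed_maximizingMeasures_graph φ).inter
    (hC.preimage continuous_snd))).isOpen_compl

/-- If a closed set `C` of measures has dense complement in the ergodic measures, then densely many
functions have no maximizing measure in `C`. -/
theorem dense_disjoint_maximizingMeasures [Nonempty K] {C : Set (ProbabilityMeasure K)}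
    (hC : IsClosed C) (hE : ergodicMeasures φ ⊆ closure (ergodicMeasures φ \ C)) :
    Dense {f : C(K, ℝ) | Disjoint (maximizingMeasures φ f) C} := by
  intro f₀
  rw [Metric.mem_closure_iff]
  intro ε hε
  obtain ⟨R, -, hR, hRu⟩ := exists_residual_unique φ
  obtain ⟨f, hfR, hf⟩ := Metric.dense_iff.1 hR f₀ (ε / 2) (half_pos hε) |>.imp fun _ h => h.symm
  obtain ⟨e, he⟩ := hRu f hfR
  have heE := mem_ergodicMeasures_of_maximizingMeasures_eq φ he
  have hemax := (mem_maximizingMeasures_iff φ).1 (he ▸ rfl : e ∈ maximizingMeasures φ f)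
  -- The same `ε / 4` bounds the defect of `μ` as a maximizing measure of `f` and the norm of the
  -- perturbation compensating it.
  obtain ⟨μ, hμ, hμE, hμC⟩ := mem_closure_iff.1 (hE heE)
    {μ | integralEval e f - ε / 4 < integralEval μ f}
    (isOpen_lt continuous_const (continuous_integralEval_right f))
    (show integralEval e f - ε / 4 < integralEval e f by linarith)
  replace hμ : integralEval e f - ε / 4 < integralEval μ f := hμ
  obtain ⟨h, hh, hlt⟩ := exists_perturbation_forall_lt hμE (C := C ∩ invariantMeasures φ)
    (hC.inter (isClosed_invariantMeasures φ)) Set.inter_subset_right (fun h => hμC h.1)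
    (f := f) (ε := ε / 4) (by positivity) (fun ρ hρ => by linarith [hemax.2 ρ hρ])
  refine ⟨f + h, ?_, ?_⟩
  · refine Set.disjoint_left.2 fun ν hν hνC => ?_
    rw [mem_maximizingMeasures_iff] at hν
    exact absurd (hν.2 μ (ergodicMeasures_subset hμE)) (not_le.2 (hlt ν ⟨hνC, hν.1⟩))
  · have h1 : dist f₀ f < ε / 2 := by rw [dist_comm]; exact hf
    have h2 : dist f (f + h) ≤ ε / 4 := by
      rwa [dist_eq_norm, sub_add_cancel_left, norm_neg]
    linarith [dist_triangle f₀ f (f + h)]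

/-- A residual set of functions whose maximizing measure is unique and avoids countably many given
closed sets of measures, each of which has dense complement in the ergodic measures. -/
theorem exists_residual_unique_notMem [Nonempty K] {C : ℕ → Set (ProbabilityMeasure K)}
    (hC : ∀ n, IsClosed (C n))
    (hE : ∀ n, ergodicMeasures φ ⊆ closure (ergodicMeasures φ \ C n)) :
    ∃ R : Set C(K, ℝ), IsGδ R ∧ Dense R ∧ ∀ f ∈ R, ∃ μ : ProbabilityMeasure K,
      maximizingMeasures φ f = {μ} ∧ μ ∈ ergodicMeasures φ ∧ ∀ n, μ ∉ C n := by
  obtain ⟨R, hRG, hRd, hRu⟩ := exists_residual_unique φ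
  have hopen := fun n => isOpen_disjoint_maximizingMeasures φ (hC n)
  have hG : IsGδ (⋂ n, {f : C(K, ℝ) | Disjoint (maximizingMeasures φ f) (C n)}) :=
    .iInter_of_isOpen hopen
  refine ⟨R ∩ ⋂ n, {f : C(K, ℝ) | Disjoint (maximizingMeasures φ f) (C n)},
    hRG.inter hG, hRd.inter_of_Gδ hRG hG (dense_iInter_of_isOpen hopen fun n =>
      dense_disjoint_maximizingMeasures φ (hC n) (hE n)), ?_⟩
  rintro f ⟨hfR, hf⟩
  obtain ⟨μ, hμ⟩ := hRu f hfR
  refine ⟨μ, hμ, mem_ergodicMeasures_of_maximizingMeasures_eq φ hμ, fun n hn => ?_⟩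
  exact Set.disjoint_left.1 (Set.mem_iInter.1 hf n) (hμ ▸ rfl) hn

end Generic

/-! ### Shannon entropy inequalities and a criterion for zero entropy. -/

section PartitionEntropy

variable {X : Type*} [MeasurableSpace X] {μ : Measure X} {ι κ : Type*} [Fintype ι] [Fintype κ]

theorem negMulLog_add_le {x y : ℝ} (hx : 0 ≤ x) (hy : 0 ≤ y) :
    Real.negMulLog (x + y) ≤ Real.negMulLog x + Real.negMulLog y := by
  rcases hx.eq_or_lt with rfl | hx
  · simp
  rcases hy.eq_or_lt with rfl | hy
  · simp
  have h1 := mul_le_mul_of_nonneg_left (Real.log_le_log hx (by linarith : x ≤ x + y)) hx.le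
  have h2 := mul_le_mul_of_nonneg_left (Real.log_le_log hy (by linarith : y ≤ x + y)) hy.le
  simp only [Real.negMulLog]
  linarith

theorem negMulLog_sum_le (s : Finset ι) {p : ι → ℝ} (hp : ∀ i, 0 ≤ p i) :
    Real.negMulLog (∑ i ∈ s, p i) ≤ ∑ i ∈ s, Real.negMulLog (p i) := by
  classical
  induction s using Finset.induction_on with
  | empty => simp
  | insert a s ha ih =>
    rw [Finset.sum_insert ha, Finset.sum_insert ha]
    exact (negMulLog_add_le (hp a) (Finset.sum_nonneg fun i _ => hp i)).trans (by linarith)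

variable [IsProbabilityMeasure μ]

theorem sum_measureReal_fibers {ξ : X → ι} (hξ : ∀ i, MeasurableSet (ξ ⁻¹' {i})) (s : Set X)
    (hs : MeasurableSet s) : ∑ i, μ.real (s ∩ ξ ⁻¹' {i}) = μ.real s := by
  rw [← measureReal_biUnion_finset]
  · congr 1
    ext x
    simp
  · intro i _ j _ hij
    refine Set.disjoint_left.2 fun x hx hx' => hij ?_
    exact hx.2.symm.trans hx'.2
  · exact fun i _ => hs.inter (hξ i)

theorem partitionEntropy_comp_le {ξ : X → ι} (hξ : ∀ i, MeasurableSet (ξ ⁻¹' {i})) (g : ι → κ) :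
    partitionEntropy μ (g ∘ ξ) ≤ partitionEntropy μ ξ := by
  classical
  unfold partitionEntropy
  rw [← Finset.sum_fiberwise Finset.univ g fun i => Real.negMulLog (μ.real (ξ ⁻¹' {i}))]
  refine Finset.sum_le_sum fun k _ => ?_
  have h : μ.real ((g ∘ ξ) ⁻¹' {k}) = ∑ i with g i = k, μ.real (ξ ⁻¹' {i}) := by
    rw [← measureReal_biUnion_finset]
    · congr 1
      ext x
      simp
    · intro i _ j _ hij
      exact Set.disjoint_left.2 fun x hx hx' => hij (hx.symm.trans hx')
    · exact fun i _ => hξ i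
  rw [h]
  exact negMulLog_sum_le _ fun i => measureReal_nonneg

theorem measurableSet_fiber_prodMk {ξ : X → ι} {η : X → κ}
    (hξ : ∀ i, MeasurableSet (ξ ⁻¹' {i})) (hη : ∀ j, MeasurableSet (η ⁻¹' {j})) (p : ι × κ) :
    MeasurableSet ((fun x => (ξ x, η x)) ⁻¹' {p}) := by
  convert! (hξ p.1).inter (hη p.2) using 1
  ext x
  simp [Prod.ext_iff]

/-- Gibbs' inequality: apply `log z ≤ z - 1` to `z = p i * q j / r i j`; the error terms `p i * q j
- r i j` sum to zero. -/
theorem partitionEntropy_prodMk_le {ξ : X → ι} {η : X → κ}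
    (hξ : ∀ i, MeasurableSet (ξ ⁻¹' {i})) (hη : ∀ j, MeasurableSet (η ⁻¹' {j})) :
    partitionEntropy μ (fun x => (ξ x, η x)) ≤ partitionEntropy μ ξ + partitionEntropy μ η := by
  set p : ι → ℝ := fun i => μ.real (ξ ⁻¹' {i}) with hp
  set q : κ → ℝ := fun j => μ.real (η ⁻¹' {j}) with hq
  set r : ι → κ → ℝ := fun i j => μ.real (ξ ⁻¹' {i} ∩ η ⁻¹' {j}) with hr
  have hr0 (i j) : 0 ≤ r i j := measureReal_nonneg
  have hp0 (i) : 0 ≤ p i := measureReal_nonneg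
  have hq0 (j) : 0 ≤ q j := measureReal_nonneg
  have hrp (i) : ∑ j, r i j = p i := sum_measureReal_fibers hη _ (hξ i)
  have hrq (j) : ∑ i, r i j = q j := by
    simp only [hr, Set.inter_comm (ξ ⁻¹' _)]
    exact sum_measureReal_fibers hξ _ (hη j)
  have hp1 : ∑ i, p i = 1 := by
    simpa using sum_measureReal_fibers (μ := μ) hξ Set.univ MeasurableSet.univ
  have hq1 : ∑ j, q j = 1 := by
    simpa using sum_measureReal_fibers (μ := μ) hη Set.univ MeasurableSet.univ
  have hle (i j) : Real.negMulLog (r i j) ≤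
      -(r i j * Real.log (p i)) - r i j * Real.log (q j) + (p i * q j - r i j) := by
    rcases (hr0 i j).eq_or_lt with h0 | h0
    · rw [← h0]
      simpa using mul_nonneg (hp0 i) (hq0 j)
    · have hpi : 0 < p i := h0.trans_le (measureReal_mono Set.inter_subset_left)
      have hqj : 0 < q j := h0.trans_le (measureReal_mono Set.inter_subset_right)
      have h1 := Real.log_le_sub_one_of_pos (div_pos (mul_pos hpi hqj) h0)
      rw [Real.log_div (mul_pos hpi hqj).ne' h0.ne', Real.log_mul hpi.ne' hqj.ne'] at h1
      have h2 := mul_le_mul_of_nonneg_left h1 h0.le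
      have h3 : r i j * (p i * q j / r i j - 1) = p i * q j - r i j := by
        field_simp
      rw [h3] at h2
      simp only [Real.negMulLog]
      linarith
  have hsum := Finset.sum_le_sum fun i (_ : i ∈ Finset.univ) =>
    Finset.sum_le_sum fun j (_ : j ∈ Finset.univ) => hle i j
  have hl : partitionEntropy μ (fun x => (ξ x, η x)) = ∑ i, ∑ j, Real.negMulLog (r i j) := by
    unfold partitionEntropy
    rw [Fintype.sum_prod_type]
    refine Finset.sum_congr rfl fun i _ => Finset.sum_congr rfl fun j _ => ?_
    congr 2
    ext x
    simp
  rw [hl]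
  refine hsum.trans_eq ?_
  simp only [Finset.sum_add_distrib, Finset.sum_sub_distrib, Finset.sum_neg_distrib,
    ← Finset.mul_sum, ← Finset.sum_mul, hrp, hq1, hp1]
  rw [Finset.sum_comm (f := fun i j => r i j * Real.log (q j))]
  simp only [← Finset.sum_mul, hrq]
  simp [partitionEntropy, Real.negMulLog, p, q]
  ring

theorem measurableSet_fiber_pi {J : Type*} [Fintype J] {ξ : J → X → ι}
    (hξ : ∀ n i, MeasurableSet (ξ n ⁻¹' {i})) (w : J → ι) :
    MeasurableSet ((fun x n => ξ n x) ⁻¹' {w}) := by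
  have : (fun x n => ξ n x) ⁻¹' {w} = ⋂ n, ξ n ⁻¹' {w n} := by
    ext x
    simp [funext_iff]
  rw [this]
  exact .iInter fun n => hξ n _

theorem partitionEntropy_pi_le {ξ : ℕ → X → ι} (hξ : ∀ n i, MeasurableSet (ξ n ⁻¹' {i})) (n : ℕ) :
    partitionEntropy μ (fun x (i : Fin n) => ξ i x) ≤
      ∑ i ∈ Finset.range n, partitionEntropy μ (ξ i) := by
  induction n with
  | zero =>
    have h : ∀ w : Fin 0 → ι, (fun x (i : Fin 0) => ξ i x) ⁻¹' {w} = Set.univ := fun w => by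
      ext x
      simp [eq_iff_true_of_subsingleton]
    simp [partitionEntropy, h]
  | succ n ih =>
    rw [Finset.sum_range_succ]
    have h1 := partitionEntropy_comp_le (μ := μ)
      (measurableSet_fiber_prodMk (measurableSet_fiber_pi fun i : Fin n => hξ i) (hξ n))
      (fun p : (Fin n → ι) × ι => (Fin.snoc p.1 p.2 : Fin (n + 1) → ι))
    have h2 : (fun p : (Fin n → ι) × ι => (Fin.snoc p.1 p.2 : Fin (n + 1) → ι)) ∘
        (fun x => ((fun i : Fin n => ξ i x), ξ n x)) = fun x (i : Fin (n + 1)) => ξ i x := by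
      ext x i
      refine Fin.lastCases ?_ (fun j => ?_) i <;> simp
    rw [h2] at h1
    exact h1.trans ((partitionEntropy_prodMk_le
      (measurableSet_fiber_pi fun i : Fin n => hξ i) (hξ n)).trans (by linarith))

/-- The large cell `none` contributes at most `1 - μ(none) ≤ δ`, as `negMulLog z ≤ 1 - z`; every
other cell has mass at most `δ` and contributes at most `ε`. -/
theorem partitionEntropy_option_le {ξ : X → Option ι} (hξ : ∀ i, MeasurableSet (ξ ⁻¹' {i}))
    {δ ε : ℝ} (hδ : ∀ x ∈ Set.Icc 0 δ, Real.negMulLog x ≤ ε) (h : μ.real {x | ξ x ≠ none} ≤ δ) :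
    partitionEntropy μ ξ ≤ δ + Fintype.card ι * ε := by
  have hnone : μ.real (ξ ⁻¹' {none}) = 1 - μ.real {x | ξ x ≠ none} := by
    rw [← probReal_compl_eq_one_sub]
    · congr 1
      ext x
      simp
    · exact (hξ none).compl
  unfold partitionEntropy
  rw [Fintype.sum_option]
  refine add_le_add ?_ ?_
  · refine (Real.negMulLog_le_one_sub_self measureReal_nonneg).trans ?_
    rw [hnone]
    linarith
  · refine (Finset.sum_le_sum fun i _ => hδ _ ⟨measureReal_nonneg, ?_⟩).trans_eq ?_
    · exact (measureReal_mono fun x (hx : ξ x = some i) => by simp [hx]).trans h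
    · simp

/-- A measure whose translated partitions form totally bounded families has zero entropy. -/
theorem mapEntropy_eq_zero {f : X → X} (hf : Measurable f)
    (h : ∀ (k : ℕ) (ξ : X → Fin k), Measurable ξ → ∀ δ > 0,
      ∃ (J : Type) (_ : Fintype J) (η : J → X → Fin k), (∀ j, Measurable (η j)) ∧
        ∀ n : ℕ, ∃ j, μ.real {x | ξ (f^[n] x) ≠ η j x} ≤ δ) :
    mapEntropy μ f = 0 := by
  simp only [mapEntropy, ENNReal.iSup_eq_zero]
  intro k ξ hξ
  have hlim : ∀ ε > 0, entropyOfPartition μ f ξ ≤ ENNReal.ofReal (ε + k * ε) := by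
    intro ε hε
    obtain ⟨r, hr, hrε⟩ := Metric.continuousAt_iff.1
      (Real.continuous_negMulLog.continuousAt (x := 0)) ε hε
    obtain ⟨δ, hδ0, hδ⟩ := exists_between (lt_min hr hε)
    have hsmall : ∀ x ∈ Set.Icc 0 δ, Real.negMulLog x ≤ ε := by
      intro x hx
      have := hrε (x := x) (by
        rw [Real.dist_0_eq_abs, abs_of_nonneg hx.1]
        exact hx.2.trans_lt (hδ.trans_le (min_le_left _ _)))
      rw [Real.negMulLog_zero, Real.dist_0_eq_abs] at this
      exact (le_abs_self _).trans this.le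
    obtain ⟨J, _, η, hη, hc⟩ := h k ξ hξ δ hδ0
    classical
    choose c hc using hc
    let _ : MeasurableSpace (Option (Fin k)) := ⊤
    -- `W n` records the correction needed where `η (c n)` mispredicts `ξ ∘ f^[n]`. The itinerary is
    -- a function of the fixed finite family `η` and the corrections, so the former costs a constant
    -- `A` and each time step at most `ε + k * ε`.
    let W : ℕ → X → Option (Fin k) := fun n x =>
      if ξ (f^[n] x) = η (c n) x then none else some (ξ (f^[n] x))
    have hWm : ∀ n, Measurable (W n) := fun n =>
      Measurable.ite (measurableSet_eq_fun (hξ.comp (hf.iterate n)) (hη _)) measurable_const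
        ((measurable_of_countable some).comp (hξ.comp (hf.iterate n)))
    have hWn : ∀ n i, MeasurableSet (W n ⁻¹' {i}) := fun n i => hWm n (MeasurableSet.of_discrete)
    have hWH : ∀ n, partitionEntropy μ (W n) ≤ ε + k * ε := fun n => by
      refine (partitionEntropy_option_le (hWn n) hsmall ?_).trans ?_
      · simpa [W] using hc n
      · rw [Fintype.card_fin]
        linarith [hδ.trans_le (min_le_right _ _)]
    set A := partitionEntropy μ (fun x j => η j x)
    have hbound : ∀ n : ℕ, partitionEntropy μ (itinerary f ξ n) ≤ A + n * (ε + k * ε) := by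
      intro n
      have hm1 := measurableSet_fiber_pi fun j i => hη j (measurableSet_singleton i)
      have hm2 := measurableSet_fiber_pi fun i : Fin n => hWn i
      have h1 := partitionEntropy_comp_le (μ := μ) (measurableSet_fiber_prodMk hm1 hm2)
        (fun p (i : Fin n) => (p.2 i).getD (p.1 (c i)))
      have h2 : (fun p (i : Fin n) => (p.2 i).getD (p.1 (c i))) ∘
          (fun x => ((fun j => η j x), fun i : Fin n => W i x)) = itinerary f ξ n := by
        ext x i
        by_cases hx : ξ (f^[i] x) = η (c i) x <;> simp [W, itinerary, hx]
      rw [h2] at h1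
      refine h1.trans ((partitionEntropy_prodMk_le hm1 hm2).trans ?_)
      refine add_le_add le_rfl ((partitionEntropy_pi_le hWn n).trans ?_)
      refine (Finset.sum_le_sum fun i _ => hWH i).trans_eq ?_
      rw [Finset.sum_const, Finset.card_range, nsmul_eq_mul]
    have ht : Tendsto (fun n : ℕ => ENNReal.ofReal (A / n + (ε + k * ε))) atTop
        (𝓝 (ENNReal.ofReal (ε + k * ε))) := by
      refine (ENNReal.continuous_ofReal.tendsto _).comp ?_
      simpa using (tendsto_const_div_atTop_nhds_zero_nat A).add_const (ε + k * ε)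
    rw [entropyOfPartition, ← ht.limsup_eq]
    refine limsup_le_limsup ?_
    filter_upwards [eventually_gt_atTop 0] with n hn
    refine ENNReal.ofReal_le_ofReal ?_
    have hn' : (0 : ℝ) < n := by exact_mod_cast hn
    rw [div_le_iff₀ hn', add_mul, div_mul_cancel₀ _ hn'.ne']
    linarith [hbound n]
  refine le_antisymm (ge_of_tendsto (x := 𝓝[>] (0 : ℝ))
    (f := fun ε : ℝ => ENNReal.ofReal (ε + k * ε)) ?_ ?_) zero_le
  · have hcont : Continuous fun ε : ℝ => ENNReal.ofReal (ε + k * ε) :=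
      ENNReal.continuous_ofReal.comp (by fun_prop)
    simpa using (hcont.tendsto 0).mono_left nhdsWithin_le_nhds
  · exact eventually_mem_nhdsWithin.mono hlim

end PartitionEntropy

/-! ### Periodic measures are ergodic and have zero entropy. -/

section Periodic

variable {K : Type*} [MetricSpace K] [CompactSpace K] [MeasurableSpace K] [BorelSpace K]
  {φ : Flow ℝ K}

theorem periodic_orbit {x : K} {T : ℝ} (hx : φ T x = x) :
    Function.Periodic (fun t => φ t x) T := fun t => by
  simp only [φ.map_add, hx]

theorem ae_orbitMeasure_iff (x : K) {T : ℝ} (hT : 0 < T) {p : K → Prop}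
    (hp : MeasurableSet {y | p y}) :
    (∀ᵐ y ∂(orbitMeasure φ x T), p y) ↔ ∀ᵐ t ∂(volume.restrict (Set.Ioc 0 T)), p (φ t x) := by
  rw [orbitMeasure, Measure.ae_ennreal_smul_measure_iff
    (ENNReal.ofReal_pos.2 (inv_pos.2 hT)).ne', ae_map_iff
    (continuous_orbit φ x).aemeasurable hp]

theorem ae_of_periodic {T : ℝ} (hT : 0 < T) {p : ℝ → Prop} (hp : ∀ t, p (t + T) ↔ p t)
    (h : ∀ᵐ t ∂(volume.restrict (Set.Ioc 0 T)), p t) : ∀ᵐ t, p t := by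
  have hper : Function.Periodic p T := fun t => propext (hp t)
  have hd := isAddFundamentalDomain_Ioc hT 0 volume
  rw [zero_add] at hd
  rw [ae_iff]
  refine hd.measure_zero_of_invariant _ (fun g => ?_) ?_
  · obtain ⟨n, hn⟩ := AddSubgroup.mem_zmultiples_iff.1 g.2
    ext t
    rw [Set.mem_vadd_set_iff_neg_vadd_mem]
    change ¬ p (-(g : ℝ) + t) ↔ ¬ p t
    rw [← hn, neg_add_eq_sub, hper.sub_zsmul_eq]
  · rw [ae_restrict_iff' measurableSet_Ioc, ae_iff] at h
    convert! h using 2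
    ext t
    simp only [Set.mem_inter_iff, Set.mem_ofPred_eq, Classical.not_imp]
    exact and_comm

theorem periodicMeasures_subset_invariantMeasures :
    periodicMeasures φ ⊆ invariantMeasures φ := by
  rintro μ ⟨x, T, hT, hx, hμ⟩
  replace hμ : (μ : Measure K) = orbitMeasure φ x T := hμ
  rw [mem_invariantMeasures_iff]
  intro t g
  rw [← sub_eq_zero, integralEval, integralEval, hμ]
  refine (integral_flow_orbitMeasure_sub φ x hT g t).trans ?_
  have hper : Function.Periodic (fun s => g (φ s x)) T := fun s =>
    congrArg g (periodic_orbit hx s)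
  have h : ∫ s in T..(T + t), g (φ s x) = ∫ s in (0 : ℝ)..t, g (φ s x) := by
    have h1 := intervalIntegral.integral_comp_add_right (a := 0) (b := t)
      (fun s => g (φ s x)) T
    rw [zero_add, add_comm t T] at h1
    rw [← h1]
    exact intervalIntegral.integral_congr fun s _ => hper s
  rw [h, sub_self, mul_zero]

/-- Pulled back along the orbit, an almost invariant set becomes a subset of `ℝ` almost invariant
under all translations, so it is null or conull by ergodicity of Lebesgue measure. Periodicity
carries null sets from one period to all of `ℝ`. -/
theorem periodicMeasures_subset_ergodicMeasures :
    periodicMeasures φ ⊆ ergodicMeasures φ := by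
  intro μ hμp
  refine mem_ergodicMeasures_iff.2
    ⟨periodicMeasures_subset_invariantMeasures hμp, fun s hs hst => ?_⟩
  obtain ⟨x, T, hT, hx, hμ⟩ := hμp
  replace hμ : (μ : Measure K) = orbitMeasure φ x T := hμ
  have hmeas : MeasurableSet {t : ℝ | φ t x ∈ s} := (continuous_orbit φ x).measurable hs
  have hinv : ∀ r : ℝ, (r +ᵥ ·) ⁻¹' {t : ℝ | φ t x ∈ s} =ᵐ[volume] {t : ℝ | φ t x ∈ s} := by
    intro r
    have h1 := (hst r).mem_iff
    rw [hμ, ae_orbitMeasure_iff x hT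
      ((measurable_flow φ r hs).mem.iff hs.mem).setOf] at h1
    refine (ae_of_periodic hT (fun t => ?_) h1).mono fun t ht => ?_
    · have := periodic_orbit hx t
      simp only at this
      rw [this]
    · refine propext ?_
      rw [Set.mem_preimage, ← φ.map_add] at ht
      exact ht
  have hc := aeconst_of_forall_preimage_vadd_ae_eq ℝ hmeas.nullMeasurableSet hinv
  rw [eventuallyConst_set] at hc ⊢
  rw [hμ]
  refine hc.imp (fun h => ?_) fun h => ?_
  · exact (ae_orbitMeasure_iff x hT hs).2 (ae_restrict_of_ae h)
  · exact (ae_orbitMeasure_iff x hT hs.compl).2 (ae_restrict_of_ae h)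

theorem iterate_flow_one (n : ℕ) (x : K) : (φ 1)^[n] x = φ n x := by
  induction n with
  | zero => simp
  | succ n ih =>
    rw [Function.iterate_succ_apply', ih, ← φ.map_add, Nat.cast_succ, add_comm]

/-- The translates by small times of a finite partition are close to the partition. -/
theorem tendsto_measure_translate_ne {μ : ProbabilityMeasure K} (hμ : μ ∈ invariantMeasures φ)
    {k : ℕ} {ξ : K → Fin k} (hξ : Measurable ξ) :
    Tendsto (fun t : ℝ => (μ : Measure K) {y | ξ (φ t y) ≠ ξ y}) (𝓝 0) (𝓝 0) := by
  let F : C(ℝ, C(K, K)) := ContinuousMap.curry ⟨fun p : ℝ × K => φ p.1 p.2, by fun_prop⟩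
  have hF0 : F 0 = ContinuousMap.id K := by
    ext y
    exact φ.map_zero_apply y
  have hcell (i : Fin k) : Tendsto (fun t : ℝ =>
      (μ : Measure K) (symmDiff (F t ⁻¹' (ξ ⁻¹' {i})) (F 0 ⁻¹' (ξ ⁻¹' {i})))) (𝓝 0) (𝓝 0) :=
    tendsto_measure_symmDiff_preimage_nhds_zero (F.continuous.tendsto 0)
      (Eventually.of_forall fun t => hμ t) (hμ 0)
      (hξ (measurableSet_singleton i)).nullMeasurableSet (measure_ne_top _ _)
  have hsum := tendsto_finsetSum Finset.univ fun i _ => hcell i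
  rw [Finset.sum_const_zero] at hsum
  refine tendsto_of_tendsto_of_tendsto_of_le_of_le tendsto_const_nhds hsum
    (fun _ => zero_le) fun t => ?_
  refine (measure_mono fun y hy => ?_).trans (measure_iUnion_fintype_le (μ : Measure K)
    fun i => symmDiff (F t ⁻¹' (ξ ⁻¹' {i})) (F 0 ⁻¹' (ξ ⁻¹' {i})))
  refine Set.mem_iUnion.2 ⟨ξ y, Or.inr ⟨?_, fun h => hy h⟩⟩
  rw [hF0]
  rfl

theorem flowEntropy_eq_zero_of_mem_periodicMeasures {μ : ProbabilityMeasure K}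
    (hμp : μ ∈ periodicMeasures φ) : flowEntropy φ μ = 0 := by
  have hinv := periodicMeasures_subset_invariantMeasures hμp
  obtain ⟨x, T, hT, hx, hμ⟩ := hμp
  replace hμ : (μ : Measure K) = orbitMeasure φ x T := hμ
  refine mapEntropy_eq_zero (measurable_flow φ 1) fun k ξ hξ δ hδ => ?_
  have hev := (tendsto_measure_translate_ne hinv hξ).eventually_lt_const
    (ENNReal.ofReal_pos.2 hδ)
  obtain ⟨r, hr, hrδ⟩ := Metric.eventually_nhds_iff.1 hev
  obtain ⟨F, hF, hcover⟩ := Metric.totallyBounded_iff.1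
    (isCompact_Icc (a := (0 : ℝ)) (b := T)).totallyBounded r hr
  refine ⟨F, hF.fintype, fun j y => ξ (φ j y), fun j => hξ.comp (measurable_flow φ j),
    fun n => ?_⟩
  set t : ℝ := n - ⌊(n : ℝ) / T⌋ * T with ht
  have htm : t ∈ Set.Icc 0 T := by
    have h1 := Int.floor_le ((n : ℝ) / T)
    have h2 := (Int.lt_floor_add_one ((n : ℝ) / T)).le
    rw [le_div_iff₀ hT] at h1
    rw [div_le_iff₀ hT] at h2
    constructor <;> linarith
  obtain ⟨j, hj, htj⟩ := Set.mem_iUnion₂.1 (hcover htm)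
  refine ⟨⟨j, hj⟩, ?_⟩
  have hnt : ∀ᵐ y ∂(μ : Measure K), φ n y = φ t y := by
    rw [hμ, ae_orbitMeasure_iff x hT
      (isClosed_eq (φ.continuous_toFun n) (φ.continuous_toFun t)).measurableSet]
    refine Eventually.of_forall fun s => ?_
    rw [← φ.map_add, ← φ.map_add, ht, sub_add_eq_add_sub]
    exact ((periodic_orbit hx).sub_int_mul_eq ⌊(n : ℝ) / T⌋).symm
  have hle : (μ : Measure K) {y | ξ ((φ 1)^[n] y) ≠ ξ (φ j y)} ≤
      (μ : Measure K) (φ j ⁻¹' {y | ξ (φ (t - j) y) ≠ ξ y}) := by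
    refine measure_mono_ae (hnt.mono fun y hy hne => ?_)
    change ξ (φ (t - j) (φ j y)) ≠ ξ (φ j y)
    rw [← φ.map_add, sub_add_cancel, ← hy, ← iterate_flow_one]
    exact hne
  have hm : MeasurableSet {y | ξ (φ (t - j) y) ≠ ξ y} :=
    (measurableSet_eq_fun (hξ.comp (measurable_flow φ (t - j))) hξ).compl
  rw [(hinv j).measure_preimage hm.nullMeasurableSet] at hle
  refine ENNReal.toReal_le_of_le_ofReal hδ.le (hle.trans (hrδ ?_).le)
  rwa [dist_zero_right, ← dist_eq_norm]

end Periodic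

section Main

variable {K : Type*} [MetricSpace K] [CompactSpace K] [MeasurableSpace K] [BorelSpace K]
  {φ : Flow ℝ K}

theorem PropertyS.isClosed_le_flowEntropy (h : PropertyS φ) (c : ENNReal) :
    IsClosed {μ | μ ∈ invariantMeasures φ ∧ c ≤ flowEntropy φ μ} := by
  refine IsSeqClosed.isClosed fun μs μ hμs hμ => ?_
  refine ⟨(isClosed_invariantMeasures φ).mem_of_tendsto hμ
    (Eventually.of_forall fun n => (hμs n).1), ?_⟩
  exact (le_limsup_of_frequently_le (Frequently.of_forall fun n => (hμs n).2)).trans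
    (h μs μ (fun n => (hμs n).1) hμ)

theorem exists_residual_flowEntropy_eq_zero [Nonempty K] (hP : PropertyPePlus φ)
    (hS : PropertyS φ) : ∃ R : Set C(K, ℝ), IsGδ R ∧ Dense R ∧
      ∀ f ∈ R, ∃ μ : ProbabilityMeasure K,
        maximizingMeasures φ f = {μ} ∧ flowEntropy φ μ = 0 := by
  have hE : ∀ n : ℕ, ergodicMeasures φ ⊆ closure (ergodicMeasures φ \
      {μ | μ ∈ invariantMeasures φ ∧ ((n : ENNReal) + 1)⁻¹ ≤ flowEntropy φ μ}) := by
    intro n μ hμ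
    have hzero {ν : ProbabilityMeasure K} (hν : flowEntropy φ ν = 0) :
        ν ∉ {μ | μ ∈ invariantMeasures φ ∧ ((n : ENNReal) + 1)⁻¹ ≤ flowEntropy φ μ} := by
      rintro ⟨-, h⟩
      rw [hν] at h
      simp at h
    rcases eq_or_ne (flowEntropy φ μ) 0 with h0 | h0
    · exact subset_closure ⟨hμ, hzero h0⟩
    · refine closure_mono (fun ν hν => ?_) (hP μ hμ (pos_iff_ne_zero.2 h0))
      exact ⟨periodicMeasures_subset_ergodicMeasures hν,
        hzero (flowEntropy_eq_zero_of_mem_periodicMeasures hν)⟩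
  obtain ⟨R, hG, hd, hR⟩ := exists_residual_unique_notMem φ
    (fun n : ℕ => hS.isClosed_le_flowEntropy ((n : ENNReal) + 1)⁻¹) hE
  refine ⟨R, hG, hd, fun f hf => ?_⟩
  obtain ⟨μ, hμ, hμE, hμC⟩ := hR f hf
  refine ⟨μ, hμ, ?_⟩
  by_contra h0
  obtain ⟨n, hn⟩ := ENNReal.exists_inv_nat_lt h0
  refine hμC n ⟨ergodicMeasures_subset hμE, le_trans ?_ hn.le⟩
  exact ENNReal.inv_le_inv.2 le_self_add

theorem exists_residual_support_eq_univ [Nonempty K] (hF : PropertyFs φ) :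
    ∃ R : Set C(K, ℝ), IsGδ R ∧ Dense R ∧ ∀ f ∈ R, ∃ μ : ProbabilityMeasure K,
      maximizingMeasures φ f = {μ} ∧ (μ : Measure K).support = Set.univ := by
  obtain ⟨S, hSG, hSd, hS⟩ := hF
  obtain ⟨U, hU, rfl⟩ := isGδ_iff_eq_iInter_nat.1 hSG
  choose V hV hVU using fun n => isOpen_induced_iff.1 (hU n)
  have hE : ∀ n, ergodicMeasures φ ⊆
      closure (ergodicMeasures φ \ (closure (ergodicMeasures φ) \ V n)) := by
    intro n μ hμ
    refine mem_closure_iff.2 fun W hW hμW => ?_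
    obtain ⟨ν, hνW, hνS⟩ := hSd.inter_open_nonempty (Subtype.val ⁻¹' W)
      (hW.preimage continuous_subtype_val) ⟨⟨μ, subset_closure hμ⟩, hμW⟩
    have hνV : ν.1 ∈ V n := by
      have := Set.mem_iInter.1 hνS n
      rwa [← hVU n] at this
    obtain ⟨ρ, ⟨hρW, hρV⟩, hρE⟩ := mem_closure_iff.1 ν.2 (W ∩ V n) (hW.inter (hV n)) ⟨hνW, hνV⟩
    exact ⟨ρ, hρW, hρE, fun h => h.2 hρV⟩
  obtain ⟨R, hG, hd, hR⟩ := exists_residual_unique_notMem φ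
    (C := fun n => closure (ergodicMeasures φ) \ V n)
    (fun n => isClosed_closure.sdiff (hV n)) hE
  refine ⟨R, hG, hd, fun f hf => ?_⟩
  obtain ⟨μ, hμ, hμE, hμC⟩ := hR f hf
  refine ⟨μ, hμ, hS ⟨μ, subset_closure hμE⟩ (Set.mem_iInter.2 fun n => ?_)⟩
  rw [← hVU n]
  by_contra h
  exact hμC n ⟨subset_closure hμE, h⟩

end Main

end ErgodicOptimization

theorem theoremD {K : Type*} [MetricSpace K] [CompactSpace K] [Nonempty K]
    [MeasurableSpace K] [BorelSpace K] (φ : Flow ℝ K) :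
    (∃ R₁ : Set C(K, ℝ), IsGδ R₁ ∧ Dense R₁ ∧
      ∀ f ∈ R₁, ∃ μ : ProbabilityMeasure K,
        ErgodicOptimization.maximizingMeasures φ f = {μ}) ∧
    (ErgodicOptimization.PropertyPePlus φ → ErgodicOptimization.PropertyS φ →
      ∃ R₂ : Set C(K, ℝ), IsGδ R₂ ∧ Dense R₂ ∧
        ∀ f ∈ R₂, ∃ μ : ProbabilityMeasure K,
          ErgodicOptimization.maximizingMeasures φ f = {μ} ∧
            ErgodicOptimization.flowEntropy φ μ = 0) ∧
    (ErgodicOptimization.PropertyFs φ →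
      ∃ R₃ : Set C(K, ℝ), IsGδ R₃ ∧ Dense R₃ ∧
        ∀ f ∈ R₃, ∃ μ : ProbabilityMeasure K,
          ErgodicOptimization.maximizingMeasures φ f = {μ} ∧
            (μ : Measure K).support = Set.univ) :=
  ⟨ErgodicOptimization.exists_residual_unique φ,
    ErgodicOptimization.exists_residual_flowEntropy_eq_zero,
    ErgodicOptimization.exists_residual_support_eq_univ⟩
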